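/- Let $(\mathbb K,|\cdot|)$ be an algebraically closed field equipped with a (real-valued, multiplicative) absolute value. Let $f\in\mathbb K[z]$ be a polynomial of degree $n\ge 2$ with leading coefficient $a_0$, let $N\ge 1$ be an integer, let $1\le p\le\infty$, let $q$ be the conjugate exponent ($1/p+1/q=1$), and put $a=(n-1)^{1/q}$. For $x\in\mathbb K^n$ with distinct components let $$W_f(x)=(W_1(x),\dots,W_n(x)),\quad W_i(x)=\frac{f(x_i)}{a_0\prod_{j\ne i}(x_i-x_j)},\qquad d_i(x)=\min_{j\ne i}|x_i-x_j|,$$ $$E_f(x)=\Big\|\Big(\frac{|W_1(x)|}{d_1(x)},\dots,\frac{|W_n(x)|}{d_n(x)}\Big)\Big\|_p .$$ Define iteration functions $T^{(N)}\colon D_N\subset\mathbb K^n\to\mathbb K^n$ recursively by $D_0=\mathbb K^n$, $T^{(0)}(x)=x$ and $$T^{(N+1)}_i(x)=x_i-\frac{f(x_i)}{f'(x_i)-f(x_i)\sum_{j\ne i}\frac1{x_i-T^{(N)}_j(x)}}\qquad(i=1,\dots,n),$$ where $D_{N+1}$ is the set of all $x\in D_N$ such that $x_i\ne T^{(N)}_j(x)$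 for all $i\ne j$ and $f'(x_i)-f(x_i)\sum_{j\ne i}\frac1{x_i-T^{(N)}_j(x)}\ne0$ for all $i$. The $N$-th Ehrlich-type iteration is $x^{(k+1)}=T^{(N)}(x^{(k)})$, $k=0,1,2,\dots$. A root-vector of $f$ is a vector $\xi\in\mathbb K^n$ with $f(z)=c\prod_{i=1}^n(z-\xi_i)$ for all $z\in\mathbb K$, for some $c\in\mathbb K$. **Theorem.** Suppose $x^{(0)}\in\mathbb K^n$ has distinct components and $$E_f(x^{(0)})<\frac{8}{(3+\sqrt{1+8a})^2}.$$ Then $f$ has only simple zeros in $\mathbb K$, and the iteration $x^{(k+1)}=T^{(N)}(x^{(k)})$ is well-defined (that is, $x^{(k)}\in D_N$ for every $k\ge0$) and converges to a root-vector $\xi$ of $f$ with order of convergence $2N+1$, that is, $x^{(k)}\to\xi$ and there is a constant $C$ with $\|x^{(k+1)}-\xi\|_\infty\le C\,\|x^{(k)}-\xi\|_\infty^{2N+1}$ for all $k\ge 0$. Moreover, for every $k\ge0$ such that $E_f(x^{(k)})<8/(3+\sqrt{1+8a})^2$, the a posteriori error estimate $$|x^{(k)}_i-\xi_i|\le\alpha\big(E_f(x^{(k)})\big)\,|W_i(x^{(k)})|\qquad(i=1,\dots,n)$$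 holds, where $$\alpha(t)=\frac{2}{1-(a-1)t+\sqrt{(1-(a-1)t)^2-4t}} .$$ -/

import Mathlib

noncomputable section

/-- `ξ` is a root-vector of `f`: `f(z) = a₀ ∏ᵢ (z - ξᵢ)` for all `z`, for some scalar `a₀`. -/
def IsRootVector {K : Type*} [Field K] {n : ℕ} (f : Polynomial K) (ξ : Fin n → K) : Prop :=
  ∃ a₀ : K, ∀ z : K, f.eval z = a₀ * ∏ i, (z - ξ i)

/-- All zeros of `f` in `K` are simple. -/
def HasOnlySimpleZeros {K : Type*} [Field K] (f : Polynomial K) : Prop :=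
  ∀ z : K, f.IsRoot z → f.rootMultiplicity z = 1

/-- The Weierstrass correction
`W_i(x) = f(x_i) / (a₀ ∏_{j ≠ i} (x_i - x_j))`, with `a₀` the leading coefficient of `f`
(meaningful when the components of `x` are distinct). -/
def weierstrassCorrection {K : Type*} [Field K] {n : ℕ} (f : Polynomial K) (x : Fin n → K) :
    Fin n → K :=
  fun i => f.eval (x i) / (f.leadingCoeff * ∏ j ∈ Finset.univ.erase i, (x i - x j))

/-- `d_i(x) = min_{j ≠ i} |x_i - x_j|`; for `n ≥ 2` the infimum is over a finite non-empty
index set, hence a minimum. -/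
def minDist {K : Type*} [NormedField K] {n : ℕ} (x : Fin n → K) : Fin n → ℝ :=
  fun i => ⨅ j : {j : Fin n // j ≠ i}, ‖x i - x j‖

/-- The real vector `x / y = (|x_1| / y_1, …, |x_n| / y_n)` for `x ∈ Kⁿ`, `y ∈ ℝⁿ`. -/
def absQuotient {K : Type*} [NormedField K] {n : ℕ} (x : Fin n → K) (y : Fin n → ℝ) :
    Fin n → ℝ :=
  fun i => ‖x i‖ / y i

/-- The usual `ℓ^p` norm of a real vector, `1 ≤ p ≤ ∞`. -/
def lpNormVec {n : ℕ} (p : ENNReal) (v : Fin n → ℝ) : ℝ :=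
  ‖(WithLp.toLp p v : PiLp p (fun _ : Fin n => ℝ))‖

/-- The function of initial conditions `E_f(x) = ‖W_f(x) / d(x)‖_p`. -/
def initialFunctional {K : Type*} [NormedField K] {n : ℕ} (p : ENNReal) (f : Polynomial K)
    (x : Fin n → K) : ℝ :=
  lpNormVec p (absQuotient (weierstrassCorrection f x) (minDist x))

/-- `x # y`: `x_i ≠ y_j` whenever `i ≠ j`. -/
def OffDiagNe {K : Type*} {n : ℕ} (x y : Fin n → K) : Prop :=
  ∀ i j : Fin n, i ≠ j → x i ≠ y j

/-- The denominator `f'(x_i) - f(x_i) ∑_{j ≠ i} 1 / (x_i - y_j)`. -/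
def ehrlichDenom {K : Type*} [Field K] {n : ℕ} (f : Polynomial K) (x y : Fin n → K)
    (i : Fin n) : K :=
  f.derivative.eval (x i) - f.eval (x i) * ∑ j ∈ Finset.univ.erase i, 1 / (x i - y j)

/-- The iteration functions `T^(N)`: `T^(0)(x) = x` and
`T^(N+1)_i(x) = x_i - f(x_i) / (f'(x_i) - f(x_i) ∑_{j ≠ i} 1 / (x_i - T^(N)_j(x)))`.
They are meaningful on `ehrlichDomain f N`. -/
def ehrlichMap {K : Type*} [Field K] {n : ℕ} (f : Polynomial K) :
    ℕ → (Fin n → K) → (Fin n → K)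
  | 0, x => x
  | N + 1, x => fun i => x i - f.eval (x i) / ehrlichDenom f x (ehrlichMap f N x) i

/-- The domains `D_N` of the iteration functions `T^(N)`. -/
def ehrlichDomain {K : Type*} [Field K] {n : ℕ} (f : Polynomial K) : ℕ → Set (Fin n → K)
  | 0 => Set.univ
  | N + 1 => {x | x ∈ ehrlichDomain f N ∧ OffDiagNe x (ehrlichMap f N x) ∧
      ∀ i, ehrlichDenom f x (ehrlichMap f N x) i ≠ 0}

/-- The `N`-th Ehrlich-type iteration `x^(k+1) = T^(N)(x^(k))` started at `x₀`. -/
def ehrlichIterate {K : Type*} [Field K] {n : ℕ} (f : Polynomial K) (N : ℕ) (x₀ : Fin n → K) :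
    ℕ → (Fin n → K)
  | 0 => x₀
  | k + 1 => ehrlichMap f N (ehrlichIterate f N x₀ k)

/-- `u` converges to `l` with order of convergence (at least) `r`: `u k → l` and
`‖u (k+1) - l‖ ≤ C ‖u k - l‖ ^ r` for a constant `C`. On a finite product this does not depend
on which of the equivalent `ℓ^p` norms is used. -/
def ConvergesWithOrder {V : Type*} [NormedAddCommGroup V] (u : ℕ → V) (l : V) (r : ℕ) : Prop :=
  Filter.Tendsto u Filter.atTop (nhds l) ∧
    ∃ C : ℝ, ∀ k, ‖u (k + 1) - l‖ ≤ C * ‖u k - l‖ ^ r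

/-- `α(t) = 2 / (1 - (a - 1) t + √((1 - (a - 1) t)² - 4 t))`. -/
def errorFactor (a t : ℝ) : ℝ :=
  2 / (1 - (a - 1) * t + Real.sqrt ((1 - (a - 1) * t) ^ 2 - 4 * t))

end

open Finset

/-! Lagrange interpolation at the nodes `x` turns `f(z) = 0` into the fixed point equation `z = φ(z)
= x_i - W_i / (1 + ∑_{j ≠ i} W_j / (z - x_j))`. The bound on `E_f` makes `φ` a contraction of the
disk `|z - x_i| ≤ α |W_i|`, which therefore contains a root `ξ_i`
(`exists_isRoot_of_weierstrassCorrection_le`). Since `α E_f < 1/3`, these disks are disjoint, so the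
`ξ_i` are all the roots and are simple.

From then on `E_f` is not propagated. The invariant is `|x_i - ξ_i| ≤ u_i |x_i - x_j|` with `u`
fixed at the start: errors shrink at least as fast as distances between components can
(`separation_of_contraction`). An Ehrlich correction multiplies the error by `σ / (1 + σ)`, where
`σ` is a sum of products of the errors of `x_i` and of the inner approximations `z_j`
(`ehrlichDenom_eq`). Each of the `N` nested corrections thus gains a factor quadratic in the error
of `x`, whence the order `2N + 1`. -/

/-! ### Estimates for the `ℓ^p` norm. -/

theorem le_lpNormVec {n : ℕ} {p : ENNReal} (hp : 1 ≤ p) (v : Fin n → ℝ) (i : Fin n) :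
    v i ≤ lpNormVec p v := by
  have : Fact (1 ≤ p) := ⟨hp⟩
  exact (Real.le_norm_self _).trans
    (PiLp.norm_apply_le (WithLp.toLp p v : PiLp p (fun _ : Fin n => ℝ)) i)

/-- Hölder's inequality against the all-ones vector on the indices different from `i`. -/
theorem sum_erase_le_lpNormVec {n : ℕ} {p q : ENNReal} (hp : 1 ≤ p) (hpq : p.HolderConjugate q)
    (v : Fin n → ℝ) (hv : ∀ j, 0 ≤ v j) (i : Fin n) :
    ∑ j ∈ univ.erase i, v j ≤ ((n : ℝ) - 1) ^ (1 / q).toReal * lpNormVec p v := by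
  have hn : 1 ≤ n := Nat.one_le_of_lt i.isLt
  have hcard : ((univ.erase i).card : ℝ) = (n : ℝ) - 1 := by
    rw [card_erase_of_mem (mem_univ i), card_univ, Fintype.card_fin]
    push_cast [hn]
    rfl
  by_cases hp' : p = ⊤
  · subst hp'
    have hq : q = 1 := ENNReal.HolderConjugate.unique ⊤ q 1
    subst hq
    have h := sum_le_card_nsmul (univ.erase i) v (lpNormVec ⊤ v) fun j _ => le_lpNormVec hp v j
    rw [nsmul_eq_mul, hcard] at h
    simpa using h
  by_cases hq' : q = ⊤
  · subst hq'
    have hp1 : p = 1 := ENNReal.HolderConjugate.unique ⊤ p 1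
    subst hp1
    have h : lpNormVec 1 v = ∑ j, v j := by
      rw [lpNormVec, PiLp.norm_eq_of_L1]
      exact sum_congr rfl fun j _ => Real.norm_of_nonneg (hv j)
    rw [h]
    simpa using sum_le_sum_of_subset_of_nonneg (erase_subset i univ) fun j _ _ => hv j
  have hc := ENNReal.HolderConjugate.toReal_of_ne_top (p := p) (q := q) hp' hq'
  have h := Real.inner_le_Lp_mul_Lq (univ.erase i) v (fun _ => 1) hc
  simp only [mul_one, abs_one, Real.one_rpow, sum_const, nsmul_eq_mul, hcard] at h
  have hle : (∑ j ∈ univ.erase i, |v j| ^ p.toReal) ^ (1 / p.toReal) ≤ lpNormVec p v := by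
    rw [lpNormVec, PiLp.norm_eq_sum hc.pos]
    refine Real.rpow_le_rpow (sum_nonneg fun j _ => by positivity) ?_ (by have := hc.pos; positivity)
    exact sum_le_sum_of_subset_of_nonneg (erase_subset i univ) fun j _ _ => by positivity
  have hqr : (1 / q).toReal = 1 / q.toReal := by simp
  rw [hqr, mul_comm]
  refine h.trans (mul_le_mul_of_nonneg_right hle (Real.rpow_nonneg ?_ _))
  have : (1 : ℝ) ≤ n := by exact_mod_cast hn
  linarith

/-! ### Roots near the nodes. -/

/-- Lagrange interpolation of `f - a₀ ∏ (z - x_j)`, of degree below `n` because the leading terms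
cancel. Multiplying out the `i`-th term keeps the identity valid at `z = x_i`. -/
theorem eval_eq_mul_weierstrassCorrection {K : Type*} [Field K] {n : ℕ} {f : Polynomial K}
    (hf0 : f ≠ 0) (hf : f.natDegree = n) {x : Fin n → K} (hx : Function.Injective x)
    (i : Fin n) {z : K} (hz : ∀ j, j ≠ i → z ≠ x j) :
    f.eval z = f.leadingCoeff * (∏ j ∈ univ.erase i, (z - x j)) *
      ((1 + ∑ j ∈ univ.erase i, weierstrassCorrection f x j / (z - x j)) * (z - x i) +
        weierstrassCorrection f x i) := by
  have hlc : f.leadingCoeff ≠ 0 := Polynomial.leadingCoeff_ne_zero.mpr hf0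
  by_cases hzi : z = x i
  · subst hzi
    have hprod : ∏ j ∈ univ.erase i, (x i - x j) ≠ 0 :=
      prod_ne_zero_iff.mpr fun j hj => sub_ne_zero.mpr (hz j (ne_of_mem_erase hj))
    rw [weierstrassCorrection, sub_self, mul_zero, zero_add]
    field_simp
  have hnode : ∀ j ∈ (univ : Finset (Fin n)), z ≠ x j := fun j _ => by
    by_cases hj : j = i
    · rw [hj]; exact hzi
    · exact hz j hj
  set g : Polynomial K := Polynomial.C f.leadingCoeff * Lagrange.nodal univ x with hg
  have hnodal : (Lagrange.nodal (univ : Finset (Fin n)) x).Monic := Lagrange.nodal_monic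
  have hgdeg : f.degree = g.degree := by
    rw [hg, Polynomial.degree_C_mul hlc, Lagrange.degree_nodal, Polynomial.degree_eq_natDegree hf0,
      hf, card_univ, Fintype.card_fin]
  have hglc : f.leadingCoeff = g.leadingCoeff := by
    rw [hg, Polynomial.leadingCoeff_mul, hnodal.leadingCoeff, Polynomial.leadingCoeff_C, mul_one]
  have hdeg : (f - g).degree < ((univ : Finset (Fin n)).card : WithBot ℕ) := by
    have := Polynomial.degree_sub_lt_left hgdeg hf0 hglc
    rwa [Polynomial.degree_eq_natDegree hf0, hf, ← Fintype.card_fin n, ← card_univ] at this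
  have hint := Lagrange.eq_interpolate hx.injOn hdeg
  have heval := congrArg (Polynomial.eval z) hint
  rw [Lagrange.eval_interpolate_not_at_node _ hnode] at heval
  have hterm : ∀ j, Lagrange.nodalWeight univ x j * (z - x j)⁻¹ * Polynomial.eval (x j) (f - g) =
      f.leadingCoeff * (weierstrassCorrection f x j / (z - x j)) := by
    intro j
    have : Polynomial.eval (x j) g = 0 := by
      rw [hg, Polynomial.eval_mul, Lagrange.eval_nodal_at_node (mem_univ j), mul_zero]
    rw [Polynomial.eval_sub, this, sub_zero, weierstrassCorrection, Lagrange.nodalWeight,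
      prod_inv_distrib]
    field_simp
  rw [sum_congr rfl fun j _ => hterm j, ← mul_sum, Polynomial.eval_sub, hg, Polynomial.eval_mul,
    Polynomial.eval_C, Lagrange.eval_nodal, ← add_sum_erase _ _ (mem_univ i),
    ← mul_prod_erase _ _ (mem_univ i), sub_eq_iff_eq_add] at heval
  rw [heval]
  have : z - x i ≠ 0 := sub_ne_zero.mpr hzi
  field_simp
  ring

/-- A root lies in the disk `|z - x_i| ≤ α |W_i|` as soon as the fixed point map
`z ↦ x_i - W_i / (1 + ∑_{j ≠ i} W_j / (z - x_j))` is a contraction of that disk. -/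
theorem exists_isRoot_of_weierstrassCorrection_le {K : Type*} [NormedField K] [IsAlgClosed K]
    {n : ℕ} {f : Polynomial K} (hf0 : f ≠ 0) (hf : f.natDegree = n) {x : Fin n → K}
    (hx : Function.Injective x) (i : Fin n) {w : Fin n → ℝ} {a t α : ℝ}
    (hW : ∀ i j, i ≠ j → ‖weierstrassCorrection f x i‖ ≤ w i * ‖x i - x j‖)
    (ht : 0 ≤ t) (ha : 0 ≤ a) (hα : 0 < α) (hwt : ∀ i, w i ≤ t)
    (hsum : ∀ i, ∑ j ∈ univ.erase i, w j ≤ a * t)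
    (hαt : α * (1 - α * t - a * t) = 1 - α * t) (hαt1 : α * t < 1)
    (hcontr : a * (α * t) ^ 2 < (1 - α * t) ^ 2) :
    ∃ z, f.IsRoot z ∧ ‖z - x i‖ ≤ α * ‖weierstrassCorrection f x i‖ := by
  -- `K` need not be complete, so Banach's theorem is unavailable. Instead, without a root in the
  -- disk `|f|` has a positive lower bound there, while `f` tends to `0` along the iterates of `φ`.
  by_contra! hno
  set W := weierstrassCorrection f x with hWdef
  set h := α * t with hh
  set B : K → K := fun z => 1 + ∑ j ∈ univ.erase i, W j / (z - x j) with hB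
  set φ : K → K := fun z => x i - W i / B z with hφ
  have h1h : 0 < 1 - h := by linarith
  have hlc : f.leadingCoeff ≠ 0 := Polynomial.leadingCoeff_ne_zero.mpr hf0
  have hxpos : ∀ j, j ≠ i → 0 < ‖x i - x j‖ := fun j hj =>
    norm_pos_iff.mpr (sub_ne_zero.mpr (hx.ne hj.symm))
  have hdist : ∀ z, ‖z - x i‖ ≤ α * ‖W i‖ → ∀ j, j ≠ i →
      (1 - h) * ‖x i - x j‖ ≤ ‖z - x j‖ := by
    intro z hz j hj
    have h1 : ‖W i‖ ≤ t * ‖x i - x j‖ :=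
      (hW i j hj.symm).trans (mul_le_mul_of_nonneg_right (hwt i) (norm_nonneg _))
    have h2 : ‖x i - x j‖ ≤ ‖z - x j‖ + ‖z - x i‖ := by
      have := norm_sub_le (z - x j) (z - x i)
      rwa [sub_sub_sub_cancel_left] at this
    have h3 := mul_le_mul_of_nonneg_left h1 hα.le
    rw [hh]; nlinarith
  have hterm : ∀ z, ‖z - x i‖ ≤ α * ‖W i‖ → ∀ j, j ≠ i → ‖W j / (z - x j)‖ ≤ w j / (1 - h) := by
    intro z hz j hj
    have h1 := hdist z hz j hj
    have h2 : 0 < ‖z - x j‖ := (mul_pos h1h (hxpos j hj)).trans_le h1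
    rw [norm_div, div_le_div_iff₀ h2 h1h]
    have h3 := hW j i hj
    rw [norm_sub_rev] at h3
    have hw : 0 ≤ w j := nonneg_of_mul_nonneg_left ((norm_nonneg _).trans h3) (hxpos j hj)
    nlinarith [mul_le_mul_of_nonneg_left h1 hw, mul_le_mul_of_nonneg_right h3 h1h.le]
  have hS : ∀ z, ‖z - x i‖ ≤ α * ‖W i‖ →
      ‖∑ j ∈ univ.erase i, W j / (z - x j)‖ ≤ a * t / (1 - h) := by
    intro z hz
    refine (norm_sum_le_of_le _ fun j hj => hterm z hz j (ne_of_mem_erase hj)).trans ?_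
    rw [← sum_div]
    exact div_le_div_of_nonneg_right (hsum i) h1h.le
  -- This relation fixes `α`: it gives `|B| ≥ 1 / α`, exactly what `φ` needs to preserve the disk of
  -- radius `α |W_i|`.
  have hinv : 1 - a * t / (1 - h) = 1 / α := by
    field_simp
    linarith
  have hBlow : ∀ z, ‖z - x i‖ ≤ α * ‖W i‖ → 1 / α ≤ ‖B z‖ := by
    intro z hz
    have h1 := hS z hz
    have h2 : ‖(1 : K)‖ ≤ ‖B z‖ + ‖∑ j ∈ univ.erase i, W j / (z - x j)‖ := by
      have := norm_sub_le (B z) (∑ j ∈ univ.erase i, W j / (z - x j))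
      rwa [hB, add_sub_cancel_right] at this
    rw [norm_one] at h2
    linarith
  have hBup : ∀ z, ‖z - x i‖ ≤ α * ‖W i‖ → ‖B z‖ ≤ 2 := by
    intro z hz
    have h1 := hS z hz
    have h2 : ‖B z‖ ≤ 1 + _ := (norm_add_le _ _).trans_eq (by rw [norm_one])
    have : 0 < 1 / α := by positivity
    linarith
  have hBpos : ∀ z, ‖z - x i‖ ≤ α * ‖W i‖ → 0 < ‖B z‖ := fun z hz =>
    (by positivity : (0 : ℝ) < 1 / α).trans_le (hBlow z hz)
  have hself : ∀ z, ‖z - x i‖ ≤ α * ‖W i‖ → ‖φ z - x i‖ ≤ α * ‖W i‖ := by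
    intro z hz
    rw [hφ]
    simp only [sub_sub_cancel_left, norm_neg, norm_div]
    rw [div_le_iff₀ (hBpos z hz)]
    have h1 := mul_le_mul_of_nonneg_left (hBlow z hz) (mul_nonneg hα.le (norm_nonneg (W i)))
    calc ‖W i‖ = α * ‖W i‖ * (1 / α) := by field_simp
      _ ≤ _ := h1
  set L : ℝ := a * h ^ 2 / (1 - h) ^ 2 with hL
  have hL0 : 0 ≤ L := by positivity
  have hL1 : L < 1 := (div_lt_one (by positivity)).mpr hcontr
  have hlip : ∀ z y, ‖z - x i‖ ≤ α * ‖W i‖ → ‖y - x i‖ ≤ α * ‖W i‖ →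
      ‖φ z - φ y‖ ≤ L * ‖z - y‖ := by
    intro z y hz hy
    have hBz : B z ≠ 0 := norm_pos_iff.mp (hBpos z hz)
    have hBy : B y ≠ 0 := norm_pos_iff.mp (hBpos y hy)
    have e1 : φ z - φ y = W i * (B z - B y) / (B z * B y) := by
      simp only [hφ]
      field_simp
      ring
    have hWd : ‖W i‖ * ‖B z - B y‖ ≤ t * (a * t / (1 - h) ^ 2 * ‖z - y‖) := by
      have e2 : W i * (B z - B y) = ∑ j ∈ univ.erase i, W i * (W j / (z - x j) - W j / (y - x j)) := by
        simp only [hB, add_sub_add_left_eq_sub, ← sum_sub_distrib, ← mul_sum]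
      rw [← norm_mul, e2]
      have e3 : t * (a * t / (1 - h) ^ 2 * ‖z - y‖) = (a * t) * (t / (1 - h) ^ 2 * ‖z - y‖) := by
        ring
      rw [e3]
      have hpos : 0 ≤ t / (1 - h) ^ 2 * ‖z - y‖ := by positivity
      refine le_trans (norm_sum_le_of_le (f := fun j => W i * (W j / (z - x j) - W j / (y - x j)))
        (n := fun j => w j * (t / (1 - h) ^ 2 * ‖z - y‖)) _ fun j hj => ?_) ?_
      · have hj := ne_of_mem_erase hj
        have hz1 := hdist z hz j hj
        have hz2 : 0 < ‖z - x j‖ := (mul_pos h1h (hxpos j hj)).trans_le hz1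
        have hy1 := hdist y hy j hj
        have hy2 : 0 < ‖y - x j‖ := (mul_pos h1h (hxpos j hj)).trans_le hy1
        have hz3 : z - x j ≠ 0 := norm_pos_iff.mp hz2
        have hy3 : y - x j ≠ 0 := norm_pos_iff.mp hy2
        have e4 : W i * (W j / (z - x j) - W j / (y - x j)) =
            (W i / (y - x j)) * (W j / (z - x j)) * (y - z) := by
          field_simp
          ring
        have h1 : ‖W i / (y - x j)‖ ≤ t / (1 - h) := by
          rw [norm_div, div_le_div_iff₀ hy2 h1h]
          have h2 : ‖W i‖ ≤ t * ‖x i - x j‖ :=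
            (hW i j hj.symm).trans (mul_le_mul_of_nonneg_right (hwt i) (norm_nonneg _))
          nlinarith [mul_le_mul_of_nonneg_left hy1 ht, mul_le_mul_of_nonneg_right h2 h1h.le]
        rw [e4, norm_mul, norm_mul, norm_sub_rev y z]
        calc _ ≤ t / (1 - h) * (w j / (1 - h)) * ‖z - y‖ := by
              gcongr
              exact hterm z hz j hj
          _ = _ := by field_simp
      · rw [← sum_mul]
        exact mul_le_mul_of_nonneg_right (hsum i) hpos
    rw [e1, norm_div, norm_mul, norm_mul, div_le_iff₀ (mul_pos (hBpos z hz) (hBpos y hy))]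
    refine hWd.trans ?_
    have h1 : 1 / α * (1 / α) ≤ ‖B z‖ * ‖B y‖ :=
      mul_le_mul (hBlow z hz) (hBlow y hy) (by positivity) (norm_nonneg _)
    calc t * (a * t / (1 - h) ^ 2 * ‖z - y‖) = L * ‖z - y‖ * (1 / α * (1 / α)) := by
          rw [hL, hh]; field_simp
      _ ≤ _ := mul_le_mul_of_nonneg_left h1 (by positivity)
  set u : ℕ → K := fun k => φ^[k] (x i) with hu
  have husucc : ∀ k, u (k + 1) = φ (u k) := fun k => Function.iterate_succ_apply' φ k (x i)
  have humem : ∀ k, ‖u k - x i‖ ≤ α * ‖W i‖ := by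
    intro k
    induction k with
    | zero => simp only [hu, Function.iterate_zero, id, sub_self, norm_zero]; positivity
    | succ k ih => rw [husucc]; exact hself _ ih
  have hustep : ∀ k, ‖u k - φ (u k)‖ ≤ L ^ k * ‖u 0 - φ (u 0)‖ := by
    intro k
    induction k with
    | zero => simp
    | succ k ih =>
      rw [pow_succ', mul_assoc]
      calc ‖u (k + 1) - φ (u (k + 1))‖ = ‖φ (u k) - φ (u (k + 1))‖ := by rw [husucc k]
        _ ≤ L * ‖u k - u (k + 1)‖ := hlip _ _ (humem k) (humem (k + 1))
        _ ≤ _ := by rw [husucc k]; exact mul_le_mul_of_nonneg_left ih hL0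
  have hfac : ∀ z, ‖z - x i‖ ≤ α * ‖W i‖ → f.eval z =
      f.leadingCoeff * (∏ j ∈ univ.erase i, (z - x j)) * (B z * (z - φ z)) := by
    intro z hz
    have hBz : B z ≠ 0 := norm_pos_iff.mp (hBpos z hz)
    have hne : ∀ j, j ≠ i → z ≠ x j := fun j hj => sub_ne_zero.mp <| norm_pos_iff.mp <|
      (mul_pos h1h (hxpos j hj)).trans_le (hdist z hz j hj)
    rw [eval_eq_mul_weierstrassCorrection hf0 hf hx i hne]
    congr 1
    simp only [hφ]
    rw [← hWdef]
    change B z * (z - x i) + W i = _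
    field_simp
    ring
  set M : ℝ := ‖f.leadingCoeff‖ * (∏ j ∈ univ.erase i, (α * ‖W i‖ + ‖x i - x j‖)) * 2 with hM
  have hupper : ∀ z, ‖z - x i‖ ≤ α * ‖W i‖ → ‖f.eval z‖ ≤ M * ‖z - φ z‖ := by
    intro z hz
    rw [hfac z hz, norm_mul, norm_mul, norm_mul, norm_prod, hM, ← mul_assoc]
    gcongr with j hj
    · have := norm_add_le (z - x i) (x i - x j)
      rw [sub_add_sub_cancel] at this
      linarith
    · exact hBup z hz
  -- Each factor bounds `|z - ζ|` from below on the disk; it is positive because every root `ζ` lies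
  -- outside.
  set m : ℝ := ‖f.leadingCoeff‖ *
    (f.roots.map fun ζ => ‖ζ - x i‖ - α * ‖W i‖).prod with hm
  have hlower : ∀ z, ‖z - x i‖ ≤ α * ‖W i‖ → m ≤ ‖f.eval z‖ := by
    intro z hz
    have hnorm : ‖(f.roots.map fun ζ => z - ζ).prod‖ = (f.roots.map fun ζ => ‖z - ζ‖).prod :=
      (map_multiset_prod (normHom (α := K)) _).trans (by rw [Multiset.map_map]; rfl)
    rw [(IsAlgClosed.splits f).eval_eq_prod_roots, norm_mul, hm, hnorm]
    refine mul_le_mul_of_nonneg_left (Multiset.prod_map_le_prod_map₀ _ _ (fun ζ hζ => ?_)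
      fun ζ hζ => ?_) (norm_nonneg _)
    · exact sub_nonneg.mpr (hno ζ (Polynomial.isRoot_of_mem_roots hζ)).le
    · have := norm_sub_le (z - x i) (z - ζ)
      rw [sub_sub_sub_cancel_left] at this
      linarith
  have hmpos : 0 < m := by
    refine mul_pos (norm_pos_iff.mpr hlc) (Multiset.prod_pos fun r hr => ?_)
    obtain ⟨ζ, hζ, rfl⟩ := Multiset.mem_map.mp hr
    exact sub_pos.mpr (hno ζ (Polynomial.isRoot_of_mem_roots hζ))
  have hlim : Filter.Tendsto (fun k => M * (L ^ k * ‖u 0 - φ (u 0)‖)) Filter.atTop (nhds 0) := by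
    have := ((tendsto_pow_atTop_nhds_zero_of_lt_one hL0 hL1).mul_const ‖u 0 - φ (u 0)‖).const_mul M
    simpa using this
  have hM0 : 0 ≤ M := by positivity
  refine absurd (ge_of_tendsto' hlim fun k => ?_) (not_le.mpr hmpos)
  exact (hlower _ (humem k)).trans ((hupper _ (humem k)).trans
    (mul_le_mul_of_nonneg_left (hustep k) hM0))

/-! ### The scalar inequalities behind the threshold. -/

/-- `α` is the smaller root of `t α² - A α + 1 = 0` with `A = 1 - (a - 1) t` (the only root if `t =
0`). With `s = √(1 + 8a)`, the threshold `8 / (s + 3)²` yields `α t (s + 3) < 2`, which implies the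
last two bounds. -/
theorem errorFactor_spec {a t : ℝ} (ha : 1 ≤ a) (ht : 0 ≤ t)
    (h : t < 8 / (3 + Real.sqrt (1 + 8 * a)) ^ 2) :
    0 < errorFactor a t ∧
    errorFactor a t * (1 - errorFactor a t * t - a * t) = 1 - errorFactor a t * t ∧
    errorFactor a t * t < 1 / 3 ∧
    2 * (a * (errorFactor a t * t) ^ 2) <
      (1 - errorFactor a t * t) * (1 - 2 * (errorFactor a t * t)) := by
  have hs2 : Real.sqrt (1 + 8 * a) ^ 2 = 1 + 8 * a := Real.sq_sqrt (by linarith)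
  have hs3 : 3 ≤ Real.sqrt (1 + 8 * a) := Real.le_sqrt_of_sq_le (by linarith)
  generalize Real.sqrt (1 + 8 * a) = s at h hs2 hs3
  obtain rfl : a = (s ^ 2 - 1) / 8 := by linarith
  have hτ : t * (s + 3) ^ 2 < 8 := by
    rw [lt_div_iff₀ (by positivity)] at h
    rwa [add_comm s 3]
  set A := 1 - ((s ^ 2 - 1) / 8 - 1) * t with hA
  have hA6 : 6 ≤ A * (s + 3) := by
    have : A * (s + 3) = s + 3 - (s - 3) * (t * (s + 3) ^ 2) / 8 := by rw [hA]; ring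
    nlinarith
  have hA0 : 0 < A := pos_of_mul_pos_left (by linarith : 0 < A * (s + 3)) (by linarith)
  have hD : (2 / (s + 3)) ^ 2 ≤ A ^ 2 - 4 * t := by
    rw [div_pow, div_le_iff₀ (by positivity)]
    nlinarith
  have hsq : 2 / (s + 3) ≤ Real.sqrt (A ^ 2 - 4 * t) := Real.le_sqrt_of_sq_le hD
  have hsq2 : Real.sqrt (A ^ 2 - 4 * t) ^ 2 = A ^ 2 - 4 * t :=
    Real.sq_sqrt ((sq_nonneg _).trans hD)
  set α := errorFactor ((s ^ 2 - 1) / 8) t with hα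
  have hαdef : α = 2 / (A + Real.sqrt (A ^ 2 - 4 * t)) := rfl
  set d := A + Real.sqrt (A ^ 2 - 4 * t) with hd
  have hd0 : 0 < d := add_pos_of_pos_of_nonneg hA0 (Real.sqrt_nonneg _)
  have hd8 : 8 ≤ d * (s + 3) := by
    rw [div_le_iff₀ (by linarith)] at hsq
    rw [hd, add_mul]
    linarith
  have hdq : d ^ 2 - 2 * A * d + 4 * t = 0 := by
    rw [show Real.sqrt (A ^ 2 - 4 * t) = d - A by rw [hd]; ring] at hsq2
    linarith
  have hαd : α * d = 2 := by rw [hαdef]; field_simp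
  have hα0 : 0 < α := by rw [hαdef]; positivity
  have hα4 : 4 * α ≤ s + 3 := by
    have : 8 * α ≤ 2 * (s + 3) := by
      calc 8 * α ≤ d * (s + 3) * α := mul_le_mul_of_nonneg_right hd8 hα0.le
        _ = 2 * (s + 3) := by linear_combination (s + 3) * hαd
    linarith
  have hquad : t * α ^ 2 - A * α + 1 = 0 := by
    have : d ^ 2 * (t * α ^ 2 - A * α + 1) = 0 := by
      linear_combination (t * (α * d + 2) - A * d) * hαd + hdq
    exact (mul_eq_zero.mp this).resolve_left (by positivity)
  have hh0 : 0 ≤ α * t := by positivity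
  have hh2 : α * t * (s + 3) < 2 := by
    have h1 : 4 * α * (t * (s + 3)) ≤ (s + 3) * (t * (s + 3)) :=
      mul_le_mul_of_nonneg_right hα4 (by positivity)
    nlinarith
  refine ⟨hα0, ?_, by nlinarith, ?_⟩
  · rw [hA] at hquad
    linear_combination -hquad
  -- As `8a = s² - 1`, the claim is this inequality rearranged; its square root is `α t (s + 3) <
  -- 2`.
  · have h1 : (α * t * s) ^ 2 < (2 - 3 * (α * t)) ^ 2 :=
      pow_lt_pow_left₀ (by linarith) (by positivity) two_ne_zero
    nlinarith

/-! ### Factorization over distinct roots. -/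

theorem roots_eq_map_of_injective {K : Type*} [Field K] {n : ℕ} {f : Polynomial K} (hf0 : f ≠ 0)
    (hf : f.natDegree = n) {ξ : Fin n → K} (hξ : Function.Injective ξ)
    (hroot : ∀ i, f.IsRoot (ξ i)) : f.roots = univ.val.map ξ := by
  refine (Multiset.eq_of_le_of_card_le ?_ ?_).symm
  · rw [Multiset.le_iff_subset (univ.nodup.map hξ)]
    intro z hz
    obtain ⟨i, -, rfl⟩ := Multiset.mem_map.mp hz
    exact (Polynomial.mem_roots hf0).mpr (hroot i)
  · simpa [hf] using Polynomial.card_roots' f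

theorem eq_C_mul_prod_of_injective {K : Type*} [Field K] {n : ℕ} {f : Polynomial K} (hf0 : f ≠ 0)
    (hf : f.natDegree = n) {ξ : Fin n → K} (hξ : Function.Injective ξ)
    (hroot : ∀ i, f.IsRoot (ξ i)) :
    f = Polynomial.C f.leadingCoeff * ∏ i, (Polynomial.X - Polynomial.C (ξ i)) := by
  have hr := roots_eq_map_of_injective hf0 hf hξ hroot
  have h := Polynomial.C_leadingCoeff_mul_prod_multiset_X_sub_C (p := f) (by simp [hr, hf])
  rw [hr, Multiset.map_map] at h
  exact h.symm

theorem hasOnlySimpleZeros_of_injective {K : Type*} [Field K] {n : ℕ} {f : Polynomial K}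
    (hf0 : f ≠ 0) (hf : f.natDegree = n) {ξ : Fin n → K} (hξ : Function.Injective ξ)
    (hroot : ∀ i, f.IsRoot (ξ i)) : HasOnlySimpleZeros f := by
  classical
  intro z hz
  rw [← Polynomial.count_roots]
  refine Multiset.count_eq_one_of_mem ?_ ((Polynomial.mem_roots hf0).mpr hz)
  rw [roots_eq_map_of_injective hf0 hf hξ hroot]
  exact univ.nodup.map hξ

/-! ### Ehrlich corrections. -/

/-- The logarithmic derivative of `∏_{j ≠ i} (z - ξ_j)` is compared with the sum over `z_j`, so the
inner sum vanishes when `z = ξ`. Cleared of `f(x_i)`, the identity also covers `x_i = ξ_i`. -/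
theorem ehrlichDenom_eq {K : Type*} [Field K] {n : ℕ} {f : Polynomial K} {c : K} {ξ x z : Fin n → K}
    (hf : f = Polynomial.C c * ∏ i, (Polynomial.X - Polynomial.C (ξ i))) {i : Fin n}
    (hξ : ∀ j, j ≠ i → x i ≠ ξ j) (hz : ∀ j, j ≠ i → x i ≠ z j) :
    ehrlichDenom f x z i = c * (∏ j ∈ univ.erase i, (x i - ξ j)) *
      (1 + (x i - ξ i) *
        ∑ j ∈ univ.erase i, (ξ j - z j) / ((x i - ξ j) * (x i - z j))) := by
  have hder : (Polynomial.derivative (∏ j ∈ univ.erase i,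
      (Polynomial.X - Polynomial.C (ξ j)))).eval (x i) =
      (∏ j ∈ univ.erase i, (x i - ξ j)) * ∑ j ∈ univ.erase i, 1 / (x i - ξ j) := by
    rw [Polynomial.derivative_prod_finset, Polynomial.eval_finsetSum, mul_sum]
    refine sum_congr rfl fun j hj => ?_
    have : x i - ξ j ≠ 0 := sub_ne_zero.mpr (hξ j (ne_of_mem_erase hj))
    rw [← mul_prod_erase _ _ hj]
    simp only [Polynomial.derivative_X_sub_C, mul_one, Polynomial.eval_prod, Polynomial.eval_sub,
      Polynomial.eval_X, Polynomial.eval_C]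
    field_simp
  have hsum : ∑ j ∈ univ.erase i, (ξ j - z j) / ((x i - ξ j) * (x i - z j)) =
      ∑ j ∈ univ.erase i, 1 / (x i - ξ j) - ∑ j ∈ univ.erase i, 1 / (x i - z j) := by
    rw [← sum_sub_distrib]
    refine sum_congr rfl fun j hj => ?_
    have h1 : x i - ξ j ≠ 0 := sub_ne_zero.mpr (hξ j (ne_of_mem_erase hj))
    have h2 : x i - z j ≠ 0 := sub_ne_zero.mpr (hz j (ne_of_mem_erase hj))
    field_simp
    ring
  rw [ehrlichDenom, hsum, hf, ← mul_prod_erase _ _ (mem_univ i)]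
  simp only [Polynomial.derivative_mul, Polynomial.derivative_C, zero_mul, zero_add,
    Polynomial.derivative_X_sub_C, one_mul, Polynomial.eval_mul, Polynomial.eval_add, hder,
    Polynomial.eval_prod, Polynomial.eval_sub, Polynomial.eval_X, Polynomial.eval_C]
  ring

/-- One Ehrlich correction, where `z` approximates `ξ` to within a factor `κ * P`. -/
theorem ehrlich_correction_bound {K : Type*} [NormedField K] {n : ℕ} {f : Polynomial K} {c : K}
    (hc : c ≠ 0) {ξ x z : Fin n → K}
    (hf : f = Polynomial.C c * ∏ i, (Polynomial.X - Polynomial.C (ξ i)))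
    (hx : Function.Injective x) {u : Fin n → ℝ} {r R Q κ P : ℝ} (hu0 : ∀ i, 0 ≤ u i)
    (hu : ∀ i j, i ≠ j → ‖x i - ξ i‖ ≤ u i * ‖x i - x j‖) (hur : ∀ i, u i ≤ r)
    (hQ : ∀ i, u i * ∑ j ∈ univ.erase i, u j ≤ Q) (hQ0 : 0 ≤ Q) (hQR : Q ≤ R)
    (hR : 0 < 1 - r - R) (hκ : 0 < κ) (hP0 : 0 ≤ P) (hP1 : P ≤ 1)
    (hz : ∀ j, ‖z j - ξ j‖ ≤ κ * P * ‖x j - ξ j‖)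
    (hxz : ∀ i j, i ≠ j → κ * ‖x i - x j‖ ≤ ‖x i - z j‖) :
    OffDiagNe x z ∧ ∀ i, ehrlichDenom f x z i ≠ 0 ∧
      ‖x i - f.eval (x i) / ehrlichDenom f x z i - ξ i‖ ≤
        P * (Q / (1 - r - R)) * ‖x i - ξ i‖ := by
  have hxpos : ∀ i j, i ≠ j → 0 < ‖x i - x j‖ := fun i j hij =>
    norm_pos_iff.mpr (sub_ne_zero.mpr (hx.ne hij))
  have h1r : 0 < 1 - r := by linarith
  have hxξ : ∀ i j, i ≠ j → (1 - r) * ‖x i - x j‖ ≤ ‖x i - ξ j‖ := by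
    intro i j hij
    have h1 : ‖x i - x j‖ ≤ ‖x i - ξ j‖ + ‖x j - ξ j‖ := by
      have := norm_sub_le (x i - ξ j) (x j - ξ j)
      rwa [sub_sub_sub_cancel_right] at this
    have h2 := hu j i hij.symm
    rw [norm_sub_rev (x j) (x i)] at h2
    nlinarith [mul_le_mul_of_nonneg_right (hur j) (norm_nonneg (x i - x j))]
  have hξne : ∀ i j, i ≠ j → x i ≠ ξ j := fun i j hij => sub_ne_zero.mp <| norm_pos_iff.mp <|
    (mul_pos h1r (hxpos i j hij)).trans_le (hxξ i j hij)
  have hzne : OffDiagNe x z := fun i j hij => sub_ne_zero.mp <| norm_pos_iff.mp <|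
    (mul_pos hκ (hxpos i j hij)).trans_le (hxz i j hij)
  refine ⟨hzne, fun i => ?_⟩
  set σ := (x i - ξ i) * ∑ j ∈ univ.erase i, (ξ j - z j) / ((x i - ξ j) * (x i - z j)) with hσ
  set g := c * ∏ j ∈ univ.erase i, (x i - ξ j) with hg
  have hden : ehrlichDenom f x z i = g * (1 + σ) :=
    ehrlichDenom_eq hf (fun j hj => hξne i j hj.symm) fun j hj => hzne i j hj.symm
  have hσle : ‖σ‖ ≤ P * Q / (1 - r) := by
    rw [hσ, mul_sum]
    refine (norm_sum_le_of_le (n := fun j => u i * u j * (P / (1 - r))) _ fun j hj => ?_).trans ?_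
    · have hij : i ≠ j := (ne_of_mem_erase hj).symm
      have hD := hxpos i j hij
      have h1 := hxξ i j hij
      have h2 := hxz i j hij
      have h3 := hz j
      have h4 := hu j i hij.symm
      rw [norm_sub_rev (x j) (x i)] at h4
      have h5 : ‖ξ j - z j‖ ≤ κ * P * (u j * ‖x i - x j‖) := by
        rw [norm_sub_rev]
        exact h3.trans (mul_le_mul_of_nonneg_left h4 (by positivity))
      rw [norm_mul, norm_div, norm_mul]
      have h6 : ‖ξ j - z j‖ / (‖x i - ξ j‖ * ‖x i - z j‖) ≤ κ * P * (u j * ‖x i - x j‖) /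
          ((1 - r) * ‖x i - x j‖ * (κ * ‖x i - x j‖)) := by
        have := hu0 j
        gcongr
      calc _ ≤ u i * ‖x i - x j‖ * (κ * P * (u j * ‖x i - x j‖) /
          ((1 - r) * ‖x i - x j‖ * (κ * ‖x i - x j‖))) :=
            mul_le_mul (hu i j hij) h6 (by positivity) (mul_nonneg (hu0 i) hD.le)
        _ = u i * u j * (P / (1 - r)) := by field_simp
    · rw [← sum_mul, ← mul_sum, mul_comm P Q, mul_div_assoc]
      exact mul_le_mul_of_nonneg_right (hQ i) (by positivity)
  have hσ1 : P * Q / (1 - r) ≤ R / (1 - r) := by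
    refine div_le_div_of_nonneg_right ?_ h1r.le
    nlinarith
  have h1σ : (1 - r - R) / (1 - r) ≤ ‖1 + σ‖ := by
    have h1 : ‖(1 : K)‖ ≤ ‖1 + σ‖ + ‖σ‖ := by
      have := norm_sub_le (1 + σ) σ
      rwa [add_sub_cancel_right] at this
    rw [norm_one] at h1
    have h2 : (1 - r - R) / (1 - r) = 1 - R / (1 - r) := by field_simp
    linarith
  have h1σpos : 0 < ‖1 + σ‖ := (by positivity : 0 < (1 - r - R) / (1 - r)).trans_le h1σ
  have h1σne : 1 + σ ≠ 0 := norm_pos_iff.mp h1σpos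
  have hgne : g ≠ 0 := mul_ne_zero hc <| prod_ne_zero_iff.mpr fun j hj =>
    sub_ne_zero.mpr (hξne i j (ne_of_mem_erase hj).symm)
  refine ⟨hden ▸ mul_ne_zero hgne h1σne, ?_⟩
  have heval : f.eval (x i) = (x i - ξ i) * g := by
    rw [hf, Polynomial.eval_mul, Polynomial.eval_C, Polynomial.eval_prod, hg,
      ← mul_prod_erase _ _ (mem_univ i)]
    simp only [Polynomial.eval_sub, Polynomial.eval_X, Polynomial.eval_C]
    ring
  have hstep : x i - f.eval (x i) / ehrlichDenom f x z i - ξ i = σ / (1 + σ) * (x i - ξ i) := by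
    rw [hden, heval]
    field_simp
    ring
  rw [hstep, norm_mul, norm_div]
  refine mul_le_mul_of_nonneg_right ?_ (norm_nonneg _)
  calc ‖σ‖ / ‖1 + σ‖ ≤ P * Q / (1 - r) / ((1 - r - R) / (1 - r)) := by gcongr
    _ = P * (Q / (1 - r - R)) := by field_simp

/-- `Q` is separate from `R` so that it can shrink with the error while the denominator `1 - r - R`
stays fixed: `Q = R` gives linear convergence, a quadratic `Q` the order. -/
theorem ehrlichMap_bound {K : Type*} [NormedField K] {n : ℕ} {f : Polynomial K} {c : K}
    (hc : c ≠ 0) {ξ x : Fin n → K}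
    (hf : f = Polynomial.C c * ∏ i, (Polynomial.X - Polynomial.C (ξ i)))
    (hx : Function.Injective x) {u : Fin n → ℝ} {r R Q : ℝ} (hu0 : ∀ i, 0 ≤ u i)
    (hu : ∀ i j, i ≠ j → ‖x i - ξ i‖ ≤ u i * ‖x i - x j‖) (hur : ∀ i, u i ≤ r)
    (hQ : ∀ i, u i * ∑ j ∈ univ.erase i, u j ≤ Q) (hQ0 : 0 ≤ Q) (hQR : Q ≤ R)
    (hr0 : 0 ≤ r) (hr : r < 1 / 2) (hR : 2 * R ≤ (1 - r) * (1 - 2 * r)) (N : ℕ) :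
    x ∈ ehrlichDomain f (N + 1) ∧ ∀ i, (1 + 2 * r) * ‖ehrlichMap f (N + 1) x i - ξ i‖ ≤
      ((1 + 2 * r) * (Q / (1 - r - R))) ^ (N + 1) * ‖x i - ξ i‖ := by
  have hR0 : 0 ≤ R := hQ0.trans hQR
  have hRpos : 0 < 1 - r - R := by nlinarith
  set q := (1 + 2 * r) * (Q / (1 - r - R)) with hq
  have hq0 : 0 ≤ q := by positivity
  -- For `Q = R` this is precisely the hypothesis on `2 * R`.
  have hq1 : q ≤ 1 - 2 * r := by
    rw [hq, ← mul_div_assoc, div_le_iff₀ hRpos]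
    nlinarith
  have hq1' : q ≤ 1 := by linarith
  induction N with
  | zero =>
    obtain ⟨h1, h2⟩ := ehrlich_correction_bound hc hf hx hu0 hu hur hQ hQ0 hQR hRpos
      one_pos zero_le_one le_rfl (z := x) (fun j => by simp) fun i j _ => by simp
    refine ⟨⟨Set.mem_univ x, h1, fun i => (h2 i).1⟩, fun i => ?_⟩
    have := mul_le_mul_of_nonneg_left (h2 i).2 (by linarith : 0 ≤ 1 + 2 * r)
    refine this.trans_eq ?_
    rw [hq]
    ring
  | succ N ih =>
    obtain ⟨hdom, hb⟩ := ih
    have h12 : 0 < 1 + 2 * r := by linarith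
    have hP : q ^ (N + 1) ≤ 1 - 2 * r :=
      (pow_le_of_le_one hq0 hq1' N.succ_ne_zero).trans hq1
    obtain ⟨h1, h2⟩ := ehrlich_correction_bound hc hf hx hu0 hu hur hQ hQ0 hQR hRpos
      (κ := 1 / (1 + 2 * r)) (P := q ^ (N + 1)) (by positivity) (by positivity) (by linarith)
      (z := ehrlichMap f (N + 1) x)
      (fun j => by
        rw [one_div_mul_eq_div, div_mul_eq_mul_div, le_div_iff₀ h12, mul_comm]
        exact hb j)
      -- The weight `1 + 2r` is self-consistent: `1 - r - r (1 - 2r) / (1 + 2r) = 1 / (1 + 2r)`.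
      (fun i j hij => by
        rw [one_div_mul_eq_div, div_le_iff₀ h12, mul_comm]
        have h3 := hb j
        have h4 := hu j i hij.symm
        rw [norm_sub_rev (x j) (x i)] at h4
        have h5 : ‖x j - ξ j‖ ≤ r * ‖x i - x j‖ :=
          h4.trans (mul_le_mul_of_nonneg_right (hur j) (norm_nonneg _))
        have h6 : ‖x i - x j‖ ≤ ‖x i - ehrlichMap f (N + 1) x j‖ +
            (‖ehrlichMap f (N + 1) x j - ξ j‖ + ‖x j - ξ j‖) := by
          have e : x i - x j = (x i - ehrlichMap f (N + 1) x j) +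
            ((ehrlichMap f (N + 1) x j - ξ j) - (x j - ξ j)) := by ring
          calc ‖x i - x j‖ = _ := congrArg norm e
            _ ≤ _ := (norm_add_le _ _).trans (by gcongr; exact norm_sub_le _ _)
        have h7 := mul_le_mul_of_nonneg_right hP (norm_nonneg (x j - ξ j))
        nlinarith)
    refine ⟨⟨hdom, h1, fun i => (h2 i).1⟩, fun i => ?_⟩
    have := mul_le_mul_of_nonneg_left (h2 i).2 h12.le
    refine this.trans_eq ?_
    rw [hq]
    ring

/-- By the triangle inequality distances shrink at most by the factor `(1 - 2r) / (1 + 2r)`, and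
errors shrink at least by it, so the same `u` still works. -/
theorem separation_of_contraction {K : Type*} [NormedField K] {n : ℕ} {ξ x y : Fin n → K}
    (hx : Function.Injective x) {u : Fin n → ℝ} {r : ℝ} (hu0 : ∀ i, 0 ≤ u i)
    (hu : ∀ i j, i ≠ j → ‖x i - ξ i‖ ≤ u i * ‖x i - x j‖) (hur : ∀ i, u i ≤ r)
    (hr0 : 0 ≤ r) (hr : r < 1 / 2)
    (hy : ∀ i, (1 + 2 * r) * ‖y i - ξ i‖ ≤ (1 - 2 * r) * ‖x i - ξ i‖) :
    Function.Injective y ∧ ∀ i j, i ≠ j → ‖y i - ξ i‖ ≤ u i * ‖y i - y j‖ := by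
  have h12 : 0 < 1 + 2 * r := by linarith
  have hsep : ∀ i j, i ≠ j → (1 - 2 * r) * ‖x i - x j‖ ≤ (1 + 2 * r) * ‖y i - y j‖ := by
    intro i j hij
    have h1 := (hu i j hij).trans (mul_le_mul_of_nonneg_right (hur i) (norm_nonneg _))
    have h2 := (hu j i hij.symm).trans (mul_le_mul_of_nonneg_right (hur j) (norm_nonneg _))
    rw [norm_sub_rev (x j) (x i)] at h2
    have h3 : ‖x i - x j‖ ≤ ‖y i - y j‖ +
        (‖x i - ξ i‖ + ‖x j - ξ j‖ + (‖y i - ξ i‖ + ‖y j - ξ j‖)) := by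
      have e : x i - x j = (y i - y j) +
        (((x i - ξ i) - (x j - ξ j)) - ((y i - ξ i) - (y j - ξ j))) := by ring
      calc ‖x i - x j‖ = _ := congrArg norm e
        _ ≤ _ := (norm_add_le _ _).trans (by
          gcongr
          refine (norm_sub_le _ _).trans ?_
          gcongr <;> exact norm_sub_le _ _)
    have h4 := hy i
    have h5 := hy j
    nlinarith
  refine ⟨fun i j hij => ?_, fun i j hij => ?_⟩
  · by_contra hne
    have h1 := hsep i j hne
    rw [hij, sub_self, norm_zero, mul_zero] at h1
    have h2 : 0 < ‖x i - x j‖ := norm_pos_iff.mpr (sub_ne_zero.mpr (hx.ne hne))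
    nlinarith
  · have h1 := hsep i j hij
    have h2 := mul_le_mul_of_nonneg_left (hu i j hij) (by linarith : 0 ≤ 1 - 2 * r)
    have h3 := mul_le_mul_of_nonneg_left h1 (hu0 i)
    refine le_of_mul_le_mul_left ?_ h12
    nlinarith [hy i]

/-! ### From `E_f` to componentwise bounds. -/

theorem minDist_le {K : Type*} [NormedField K] {n : ℕ} (x : Fin n → K) {i j : Fin n}
    (hij : i ≠ j) : minDist x i ≤ ‖x i - x j‖ :=
  ciInf_le (f := fun j : {j : Fin n // j ≠ i} => ‖x i - x j‖) (Set.finite_range _).bddBelow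
    ⟨j, hij.symm⟩

theorem minDist_pos {K : Type*} [NormedField K] {n : ℕ} (hn : 2 ≤ n) {x : Fin n → K}
    (hx : Function.Injective x) (i : Fin n) : 0 < minDist x i := by
  have : Nontrivial (Fin n) := Fin.nontrivial_iff_two_le.mpr hn
  obtain ⟨j, hj⟩ := exists_ne i
  have : Nonempty {j : Fin n // j ≠ i} := ⟨⟨j, hj⟩⟩
  obtain ⟨k, hk⟩ := exists_eq_ciInf_of_finite (f := fun j : {j : Fin n // j ≠ i} => ‖x i - x j‖)
  rw [minDist, ← hk]
  exact norm_pos_iff.mpr (sub_ne_zero.mpr (hx.ne k.2.symm))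

theorem norm_le_absQuotient_mul {K : Type*} [NormedField K] {n : ℕ} (hn : 2 ≤ n) {x : Fin n → K}
    (hx : Function.Injective x) (y : Fin n → K) {i j : Fin n} (hij : i ≠ j) :
    ‖y i‖ ≤ absQuotient y (minDist x) i * ‖x i - x j‖ := by
  rw [absQuotient, div_mul_eq_mul_div, le_div_iff₀ (minDist_pos hn hx i)]
  exact mul_le_mul_of_nonneg_left (minDist_le x hij) (norm_nonneg _)

theorem absQuotient_minDist_nonneg {K : Type*} [NormedField K] {n : ℕ} (hn : 2 ≤ n) {x : Fin n → K}
    (hx : Function.Injective x) (y : Fin n → K) (i : Fin n) : 0 ≤ absQuotient y (minDist x) i :=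
  div_nonneg (norm_nonneg _) (minDist_pos hn hx i).le

theorem exists_isRoot_near {K : Type*} [NormedField K] [IsAlgClosed K] {n : ℕ} (hn : 2 ≤ n)
    {f : Polynomial K} (hf : f.natDegree = n) {p q : ENNReal} (hp : 1 ≤ p)
    (hpq : p.HolderConjugate q) {a : ℝ} (ha : a = ((n : ℝ) - 1) ^ (1 / q).toReal) (ha1 : 1 ≤ a)
    {x : Fin n → K} (hx : Function.Injective x)
    (hE : initialFunctional p f x < 8 / (3 + Real.sqrt (1 + 8 * a)) ^ 2) (i : Fin n) :
    ∃ z, f.IsRoot z ∧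
      ‖z - x i‖ ≤ errorFactor a (initialFunctional p f x) * ‖weierstrassCorrection f x i‖ := by
  have hf0 : f ≠ 0 := Polynomial.ne_zero_of_natDegree_gt (n := 0) (by omega)
  set w := absQuotient (weierstrassCorrection f x) (minDist x) with hw
  have hw0 : ∀ j, 0 ≤ w j := absQuotient_minDist_nonneg hn hx _
  have hwt : ∀ j, w j ≤ initialFunctional p f x := le_lpNormVec hp w
  have ht : 0 ≤ initialFunctional p f x := (hw0 i).trans (hwt i)
  obtain ⟨h1, h2, h3, h4⟩ := errorFactor_spec ha1 ht hE
  have h5 : 0 ≤ errorFactor a (initialFunctional p f x) * initialFunctional p f x := by positivity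
  refine exists_isRoot_of_weierstrassCorrection_le hf0 hf hx i (w := w)
    (fun i j hij => norm_le_absQuotient_mul hn hx _ hij) ht (by linarith) h1 hwt (fun j => ?_) h2
    (by linarith) (by nlinarith)
  rw [ha]
  exact sum_erase_le_lpNormVec hp hpq w hw0 j

/-! ### Assembly of the theorem. -/

theorem mainTheorem1 {K : Type*} [NormedField K] [IsAlgClosed K]
    (n : ℕ) (hn : 2 ≤ n) (f : Polynomial K) (hf : f.natDegree = n)
    (N : ℕ) (hN : 1 ≤ N)
    (p q : ENNReal) (hp : 1 ≤ p) (hpq : p.HolderConjugate q)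
    (a : ℝ) (ha : a = ((n : ℝ) - 1) ^ (1 / q).toReal)
    (x₀ : Fin n → K) (hx₀ : Function.Injective x₀)
    (hE : initialFunctional p f x₀ < 8 / (3 + Real.sqrt (1 + 8 * a)) ^ 2) :
    HasOnlySimpleZeros f ∧
    (∀ k, ehrlichIterate f N x₀ k ∈ ehrlichDomain f N) ∧
    ∃ ξ : Fin n → K, IsRootVector f ξ ∧
      ConvergesWithOrder (ehrlichIterate f N x₀) ξ (2 * N + 1) ∧
      ∀ k, initialFunctional p f (ehrlichIterate f N x₀ k)
            < 8 / (3 + Real.sqrt (1 + 8 * a)) ^ 2 →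
        ∀ i, ‖ehrlichIterate f N x₀ k i - ξ i‖ ≤
          errorFactor a (initialFunctional p f (ehrlichIterate f N x₀ k)) *
            ‖weierstrassCorrection f (ehrlichIterate f N x₀ k) i‖ := by
  obtain ⟨M, rfl⟩ : ∃ M, N = M + 1 := ⟨N - 1, by omega⟩
  have hn' : (2 : ℝ) ≤ n := by exact_mod_cast hn
  have ha1 : 1 ≤ a := ha ▸ Real.one_le_rpow (by linarith) ENNReal.toReal_nonneg
  have hf0 : f ≠ 0 := Polynomial.ne_zero_of_natDegree_gt (n := 0) (by omega)
  have hlc : f.leadingCoeff ≠ 0 := Polynomial.leadingCoeff_ne_zero.mpr hf0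
  choose ξ hroot hnear using exists_isRoot_near hn hf hp hpq ha ha1 hx₀ hE
  set t := initialFunctional p f x₀
  set α := errorFactor a t
  set w := absQuotient (weierstrassCorrection f x₀) (minDist x₀) with hw
  have hw0 : ∀ j, 0 ≤ w j := absQuotient_minDist_nonneg hn hx₀ _
  have hwt : ∀ j, w j ≤ t := le_lpNormVec hp w
  have hwsum : ∀ i, ∑ j ∈ univ.erase i, w j ≤ a * t := fun i => by
    rw [ha]
    exact sum_erase_le_lpNormVec hp hpq w hw0 i
  have ht0 : 0 ≤ t := (hw0 ⟨0, by omega⟩).trans (hwt _)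
  obtain ⟨hα0, -, hr3, hR⟩ := errorFactor_spec ha1 ht0 hE
  set r := α * t with hr
  have hr0 : 0 ≤ r := by positivity
  have hr2 : r < 1 / 2 := by linarith
  set R := a * r ^ 2 with hRdef
  have hR0 : 0 ≤ R := by positivity
  set u : Fin n → ℝ := fun i => α * w i with hu
  have hu0 : ∀ i, 0 ≤ u i := fun i => mul_nonneg hα0.le (hw0 i)
  have hur : ∀ i, u i ≤ r := fun i => mul_le_mul_of_nonneg_left (hwt i) hα0.le
  have huR : ∀ i, u i * ∑ j ∈ univ.erase i, u j ≤ R := by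
    intro i
    have h1 : ∑ j ∈ univ.erase i, u j ≤ a * r := by
      rw [hu, ← mul_sum]
      exact (mul_le_mul_of_nonneg_left (hwsum i) hα0.le).trans_eq (by rw [hr]; ring)
    exact (mul_le_mul (hur i) h1 (sum_nonneg fun j _ => hu0 j) hr0).trans_eq (by rw [hRdef]; ring)
  have hsep₀ : ∀ i j, i ≠ j → ‖x₀ i - ξ i‖ ≤ u i * ‖x₀ i - x₀ j‖ := by
    intro i j hij
    rw [norm_sub_rev, hu, mul_assoc]
    exact (hnear i).trans
      (mul_le_mul_of_nonneg_left (norm_le_absQuotient_mul hn hx₀ _ hij) hα0.le)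
  -- The vector `ξ` itself is the extreme case of a contracted vector, with zero error.
  have hξ : Function.Injective ξ :=
    (separation_of_contraction hx₀ hu0 hsep₀ hur hr0 hr2 (y := ξ) fun i => by
      rw [sub_self, norm_zero, mul_zero]
      exact mul_nonneg (by linarith) (norm_nonneg _)).1
  have hfξ := eq_C_mul_prod_of_injective hf0 hf hξ hroot
  have hfeval : ∀ z, f.eval z = f.leadingCoeff * ∏ i, (z - ξ i) := fun z => by
    conv_lhs => rw [hfξ]
    simp [Polynomial.eval_prod]
  set X := ehrlichIterate f (M + 1) x₀
  have hRpos : 0 < 1 - r - R := by nlinarith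
  set c := (1 + 2 * r) * (R / (1 - r - R)) with hc
  have hc0 : 0 ≤ c := by positivity
  have hc1 : c < 1 - 2 * r := by
    rw [hc, ← mul_div_assoc, div_lt_iff₀ hRpos]
    nlinarith
  have hcpow : c ^ (M + 1) ≤ c := pow_le_of_le_one hc0 (by linarith) M.succ_ne_zero
  have hstep : ∀ k, Function.Injective (X k) →
      (∀ i j, i ≠ j → ‖X k i - ξ i‖ ≤ u i * ‖X k i - X k j‖) →
      X k ∈ ehrlichDomain f (M + 1) ∧
        ∀ i, (1 + 2 * r) * ‖X (k + 1) i - ξ i‖ ≤ c * ‖X k i - ξ i‖ := by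
    intro k hinj hsep
    obtain ⟨h1, h2⟩ := ehrlichMap_bound hlc hfξ hinj hu0 hsep hur huR hR0 le_rfl hr0 hr2 hR.le M
    exact ⟨h1, fun i => (h2 i).trans (mul_le_mul_of_nonneg_right hcpow (norm_nonneg _))⟩
  have hinv : ∀ k, Function.Injective (X k) ∧
      ∀ i j, i ≠ j → ‖X k i - ξ i‖ ≤ u i * ‖X k i - X k j‖ := by
    intro k
    induction k with
    | zero => exact ⟨hx₀, hsep₀⟩
    | succ k ih =>
      refine separation_of_contraction ih.1 hu0 ih.2 hur hr0 hr2 fun i => ?_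
      exact ((hstep k ih.1 ih.2).2 i).trans (mul_le_mul_of_nonneg_right hc1.le (norm_nonneg _))
  have hcontr : ∀ k, ‖X (k + 1) - ξ‖ ≤ c * ‖X k - ξ‖ := by
    intro k
    refine (pi_norm_le_iff_of_nonneg (by positivity)).mpr fun i => ?_
    have h1 := (hstep k (hinv k).1 (hinv k).2).2 i
    have h2 : c * ‖X k i - ξ i‖ ≤ c * ‖X k - ξ‖ :=
      mul_le_mul_of_nonneg_left (norm_le_pi_norm (X k - ξ) i) hc0
    rw [Pi.sub_apply]
    nlinarith [mul_nonneg hr0 (norm_nonneg (X (k + 1) i - ξ i))]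
  have hgeom : ∀ k, ‖X k - ξ‖ ≤ c ^ k * ‖X 0 - ξ‖ := by
    intro k
    induction k with
    | zero => simp
    | succ k ih =>
      rw [pow_succ', mul_assoc]
      exact (hcontr k).trans (mul_le_mul_of_nonneg_left ih hc0)
  have hlim : Filter.Tendsto X Filter.atTop (nhds ξ) := by
    rw [tendsto_iff_norm_sub_tendsto_zero]
    refine squeeze_zero (fun k => norm_nonneg _) hgeom ?_
    simpa using (tendsto_pow_atTop_nhds_zero_of_lt_one hc0 (by linarith)).mul_const ‖X 0 - ξ‖
  have hdistξ : ∀ k i j, i ≠ j → ‖ξ i - ξ j‖ ≤ (1 + 2 * r) * ‖X k i - X k j‖ ∧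
      (1 - r) * ‖X k i - X k j‖ ≤ ‖X k i - ξ j‖ := by
    intro k i j hij
    have h1 := ((hinv k).2 i j hij).trans (mul_le_mul_of_nonneg_right (hur i) (norm_nonneg _))
    have h2 := ((hinv k).2 j i hij.symm).trans (mul_le_mul_of_nonneg_right (hur j) (norm_nonneg _))
    rw [norm_sub_rev (X k j) (X k i)] at h2
    have h3 : ‖ξ i - ξ j‖ ≤ ‖X k i - X k j‖ + (‖X k i - ξ i‖ + ‖X k j - ξ j‖) := by
      have e : ξ i - ξ j = (X k i - X k j) - ((X k i - ξ i) - (X k j - ξ j)) := by ring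
      calc ‖ξ i - ξ j‖ = _ := congrArg norm e
        _ ≤ _ := (norm_sub_le _ _).trans (by gcongr; exact norm_sub_le _ _)
    have h4 : ‖X k i - X k j‖ ≤ ‖X k i - ξ j‖ + ‖X k j - ξ j‖ := by
      have := norm_sub_le (X k i - ξ j) (X k j - ξ j)
      rwa [sub_sub_sub_cancel_right] at this
    exact ⟨by linarith, by linarith⟩
  refine ⟨hasOnlySimpleZeros_of_injective hf0 hf hξ hroot,
    fun k => (hstep k (hinv k).1 (hinv k).2).1, ξ, ⟨f.leadingCoeff, hfeval⟩, ⟨hlim, ?_⟩, ?_⟩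
  · have : Nonempty (Fin n) := ⟨⟨0, by omega⟩⟩
    obtain ⟨i₀, hδ⟩ := Finite.exists_min (minDist ξ)
    have hδ0 := minDist_pos hn hξ i₀
    set δ := minDist ξ i₀
    -- A separation of the components valid for all iterates, since `|ξ_i - ξ_j| ≤ (1 + 2r) |X_i -
    -- X_j|`.
    set ε := δ / (1 + 2 * r) with hε
    have hε0 : 0 < ε := by positivity
    have hεle : ∀ k i j, i ≠ j → ε ≤ ‖X k i - X k j‖ := fun k i j hij => by
      rw [hε, div_le_iff₀ (by linarith), mul_comm]
      exact (hδ i).trans ((minDist_le ξ hij).trans (hdistξ k i j hij).1)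
    refine ⟨((1 + 2 * r) * (n / ε ^ 2 / (1 - r - R))) ^ (M + 1), fun k => ?_⟩
    refine (pi_norm_le_iff_of_nonneg (by positivity)).mpr fun i => ?_
    set D := ‖X k - ξ‖
    have hD0 : 0 ≤ D := norm_nonneg _
    have hDi : ∀ j, ‖X k j - ξ j‖ ≤ D := fun j => norm_le_pi_norm (X k - ξ) j
    -- The minimum keeps the smallness of `u` and adds proportionality to the error `D`, so that `Q`
    -- becomes `O(D²)`.
    set v : Fin n → ℝ := fun j => min (u j) (D / ε) with hv
    have hv0 : ∀ j, 0 ≤ v j := fun j => le_min (hu0 j) (by positivity)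
    have hvsep : ∀ i j, i ≠ j → ‖X k i - ξ i‖ ≤ v i * ‖X k i - X k j‖ := by
      intro i j hij
      rw [hv, min_mul_of_nonneg _ _ (norm_nonneg _)]
      refine le_min ((hinv k).2 i j hij) ((hDi i).trans ?_)
      calc D = D / ε * ε := by field_simp
        _ ≤ _ := mul_le_mul_of_nonneg_left (hεle k i j hij) (by positivity)
    have hvQ : ∀ i, v i * ∑ j ∈ univ.erase i, v j ≤ min R (n / ε ^ 2 * D ^ 2) := by
      intro i
      refine le_min ((mul_le_mul (min_le_left _ _) (sum_le_sum fun j _ => min_le_left _ _)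
        (sum_nonneg fun j _ => hv0 j) (hu0 i)).trans (huR i)) ?_
      have h1 : ∑ j ∈ univ.erase i, v j ≤ n * (D / ε) :=
        calc ∑ j ∈ univ.erase i, v j ≤ ∑ j, v j :=
              sum_le_sum_of_subset_of_nonneg (erase_subset _ _) fun j _ _ => hv0 j
          _ ≤ ∑ _j : Fin n, D / ε := sum_le_sum fun j _ => min_le_right _ _
          _ = n * (D / ε) := by simp
      calc v i * ∑ j ∈ univ.erase i, v j ≤ D / ε * (n * (D / ε)) :=
            mul_le_mul (min_le_right _ _) h1 (sum_nonneg fun j _ => hv0 j) (by positivity)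
        _ = n / ε ^ 2 * D ^ 2 := by field_simp
    have hb := (ehrlichMap_bound hlc hfξ (hinv k).1 hv0 hvsep
      (fun j => (min_le_left _ _).trans (hur j)) hvQ (le_min hR0 (by positivity))
      (min_le_left _ _) hr0 hr2 hR.le M).2 i
    change (1 + 2 * r) * ‖X (k + 1) i - ξ i‖ ≤ _ at hb
    have hpow : ((1 + 2 * r) * (min R (n / ε ^ 2 * D ^ 2) / (1 - r - R))) ^ (M + 1) *
        ‖X k i - ξ i‖ ≤ ((1 + 2 * r) * (n / ε ^ 2 * D ^ 2 / (1 - r - R))) ^ (M + 1) * D := by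
      have : 0 ≤ min R (n / ε ^ 2 * D ^ 2) := le_min hR0 (by positivity)
      gcongr
      · exact min_le_right _ _
      · exact hDi i
    rw [Pi.sub_apply]
    calc ‖X (k + 1) i - ξ i‖ ≤ (1 + 2 * r) * ‖X (k + 1) i - ξ i‖ :=
          le_mul_of_one_le_left (norm_nonneg _) (by linarith)
      _ ≤ _ := hb.trans hpow
      _ = ((1 + 2 * r) * (n / ε ^ 2 / (1 - r - R))) ^ (M + 1) * D ^ (2 * (M + 1) + 1) := by
          have hfactor : (1 + 2 * r) * (n / ε ^ 2 * D ^ 2 / (1 - r - R)) =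
              (1 + 2 * r) * (n / ε ^ 2 / (1 - r - R)) * D ^ 2 := by ring
          rw [pow_succ D (2 * (M + 1)), pow_mul, hfactor, mul_pow _ (D ^ 2), mul_assoc]
  · intro k hEk i
    obtain ⟨z, hz, hzi⟩ := exists_isRoot_near hn hf hp hpq ha ha1 (hinv k).1 hEk i
    have hz0 : f.leadingCoeff * ∏ j, (z - ξ j) = 0 := (hfeval z).symm.trans hz
    obtain ⟨j, -, hj⟩ := prod_eq_zero_iff.mp ((mul_eq_zero.mp hz0).resolve_left hlc)
    obtain rfl : z = ξ j := sub_eq_zero.mp hj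
    by_cases hij : i = j
    · subst hij
      rwa [norm_sub_rev]
    -- The root found near `X k i` cannot be another `ξ j`: its distance would be below a third of
    -- `|X_i - X_j|` and above two thirds of it.
    · exfalso
      set t' := initialFunctional p f (X k)
      have hle := norm_le_absQuotient_mul hn (hinv k).1 (weierstrassCorrection f (X k)) hij
      have hqt := le_lpNormVec hp
        (absQuotient (weierstrassCorrection f (X k)) (minDist (X k))) i
      change _ ≤ t' at hqt
      have ht'0 : 0 ≤ t' := (absQuotient_minDist_nonneg hn (hinv k).1 _ i).trans hqt
      obtain ⟨hα', -, hr', -⟩ := errorFactor_spec ha1 ht'0 hEk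
      have hpos : 0 < ‖X k i - X k j‖ :=
        norm_pos_iff.mpr (sub_ne_zero.mpr ((hinv k).1.ne hij))
      have h1 := (hdistξ k i j hij).2
      rw [norm_sub_rev] at hzi
      have h2 : errorFactor a t' * ‖weierstrassCorrection f (X k) i‖ ≤
          errorFactor a t' * t' * ‖X k i - X k j‖ := by
        rw [mul_assoc]
        exact mul_le_mul_of_nonneg_left
          (hle.trans (mul_le_mul_of_nonneg_right hqt hpos.le)) hα'.le
      nlinarith
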